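/- Let $\mathcal S\subset\mathbf R^n$ (the schedules) and $\mathcal A\subset\mathbf R^n$ be finite sets, $C:=\mathrm{conv}(\mathcal S)$, and let $f:\mathbf R^n\to\mathbf R$ be convex. Write $x\preceq y$ for the componentwise order, $[x]^+$ for the componentwise positive part, $\mathbf 1$ for the all-ones vector and $\|\cdot\|$ for the Euclidean norm. Arrivals. Let $A_1,A_2,\dots$ be $\mathcal A$-valued random vectors adapted to a history filtration: $\mathcal F_k$ is the history before slot $k$, and $A_k,S_k$ are $\mathcal F_{k+1}$-measurable. Suppose that $\mathbf E[A_k\mid\mathcal F_k]=\lambda$ almost surely for all $k\ge 1$ (for example, $A_k$ is independent of the history and $\mathbf E[A_k]=\lambda$). Objective. Suppose that the problem of minimizing $f(\mu)$ over $\mu\in C$ with $\lambda\preceq\mu$ has exactly one solution $\mu^\star$ (as is the case for strongly convex $f$ when the problem is feasible), and that $\lambda+\eta\mathbf 1\preceq\mu^\star$ for some $\eta>0$. Schedules. Let $S_1,S_2,\dots$ be selected by the Schedule-as-You-Learn (SYL) algorithm. With $\alpha_k=1/\sqrt k$ and $s_1=0$, for $k=1,2,\dots$, $$y_k=\arg\max_{v\succeq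 0}\{\langle s_k,v\rangle-\tfrac12\|v\|^2\},\qquad \mu_k\in\arg\min_{u\in C}\{f(u)+\langle y_k,\lambda-u\rangle\},\qquad s_{k+1}=s_k+\alpha_k(A_k-\mu_k),$$ where the selection $\mu_k$ of a minimizer is $\mathcal F_k$-measurable. In slot $k$ the running average $\bar\mu_k=\big(\sum_{i=1}^k\alpha_i\mu_i\big)/\big(\sum_{i=1}^k\alpha_i\big)$ is decomposed, in any way, as $\bar\mu_k=\sum_{\sigma\in\mathcal S}\theta_k(\sigma)\,\sigma$ with $\theta_k(\sigma)\ge0$ and $\sum_{\sigma\in\mathcal S}\theta_k(\sigma)=1$, and $S_k\in\mathcal S$ is drawn at random with these weights: $\mathrm{Prob}(S_k=\sigma\mid\mathcal F_k,A_k)=\theta_k(\sigma)$ almost surely for every $\sigma\in\mathcal S$. Conclusion. For every deterministic $Q_1\succeq 0$, the queuing system $Q_{k+1}=[Q_k+A_k-S_k]^+$ is strongly stable, that is, $$\limsup_{k\to\infty}\frac1k\sum_{i=1}^k\mathbf E[\|Q_i\|]<\infty .$$ -/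

import Mathlib

open MeasureTheory ProbabilityTheory Filter

open scoped ENNReal InnerProductSpace

namespace SYL

/-- The space `ℝⁿ` with the Euclidean norm. -/
abbrev Vec (n : ℕ) : Type := EuclideanSpace ℝ (Fin n)

/-- The componentwise order `x ⪯ y` on `ℝⁿ`. -/
def CompLE {n : ℕ} (x y : Vec n) : Prop := ∀ j, x j ≤ y j

/-- The all-ones vector. -/
noncomputable def ones (n : ℕ) : Vec n := WithLp.toLp 2 fun _ => 1

/-- The componentwise positive part `[x]⁺`. -/
noncomputable def pos {n : ℕ} (x : Vec n) : Vec n := WithLp.toLp 2 fun j => max (x j) 0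

/-- The queue backlogs: `Q₀ = q` and `Q_{k+1} = [Q_k + A_k - S_k]⁺`.
Time slots are numbered `0, 1, 2, …` throughout. -/
noncomputable def queue {n : ℕ} {Ω : Type*} (q : Vec n) (A S : ℕ → Ω → Vec n) :
    ℕ → Ω → Vec n
  | 0, _ => q
  | k + 1, ω => pos (queue q A S k ω + A k ω - S k ω)

/-- Strong stability: the time averages of the expected backlogs have a finite upper limit,
`limsup_k (1/k) ∑_{i<k} E‖Q_i‖ < ∞`. -/
def StronglyStable {n : ℕ} {Ω : Type*} [MeasurableSpace Ω] (P : Measure Ω)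
    (Q : ℕ → Ω → Vec n) : Prop :=
  limsup (fun k : ℕ => (∑ i ∈ Finset.range k, ∫⁻ ω, ‖Q i ω‖ₑ ∂P) / (k : ℝ≥0∞)) atTop < ⊤

/-- `x` is a solution of: minimize `f(μ)` subject to `μ ∈ C` and `lam ⪯ μ`. -/
def IsSolution {n : ℕ} (f : Vec n → ℝ) (C : Set (Vec n)) (lam x : Vec n) : Prop :=
  (x ∈ C ∧ CompLE lam x) ∧ IsMinOn f {u | u ∈ C ∧ CompLE lam u} x

/-- The step size `1 / √(slot number)`, where slot `k` here is the `(k+1)`-st slot. -/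
noncomputable def stepSize (k : ℕ) : ℝ := 1 / Real.sqrt ((k : ℝ) + 1)

/-- Dual averaging with regularizer `φ(v) = ‖v‖²/2` and stochastic gradients `A_k - μ_k` for the
Lagrange dual of: minimize `f(μ)` subject to `μ ∈ C` and `lam ⪯ μ`.
Here `y k` is the dual point and `x k` is the Lagrangian minimizer `μ_k`. Adding the constant
`⟪y, lam⟫` to the Lagrangian does not change its minimizers, so the iteration does not use `lam`. -/
structure IsDualAveraging {n : ℕ} {Ω : Type*} (f : Vec n → ℝ) (C : Set (Vec n)) (lam : Vec n)
    (A s y x : ℕ → Ω → Vec n) : Prop where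
  init : ∀ ω, s 0 ω = 0
  dual_nonneg : ∀ k ω, CompLE 0 (y k ω)
  dual_argmax : ∀ k ω,
    IsMaxOn (fun v => ⟪s k ω, v⟫_ℝ - (1 / 2) * ‖v‖ ^ 2) {v | CompLE 0 v} (y k ω)
  primal_mem : ∀ k ω, x k ω ∈ C
  primal_argmin : ∀ k ω, IsMinOn (fun u => f u + ⟪y k ω, lam - u⟫_ℝ) C (x k ω)
  step : ∀ k ω, s (k + 1) ω = s k ω + stepSize k • (A k ω - x k ω)

/-- The weighted running average `μ̄_k = (∑_{i≤k} α_i μ_i) / (∑_{i≤k} α_i)`. -/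
noncomputable def runningAvg {n : ℕ} {Ω : Type*} (x : ℕ → Ω → Vec n) (k : ℕ) (ω : Ω) : Vec n :=
  (∑ i ∈ Finset.range (k + 1), stepSize i)⁻¹ •
    ∑ i ∈ Finset.range (k + 1), stepSize i • x i ω

/-- An arrival process with values in the finite set `arr`; `ℱ k` is the history before slot `k`,
and given this history the arrivals of slot `k` have mean `lam`. In particular `E[A_k] = lam`. -/
structure IsArrivalProcess {n : ℕ} {Ω : Type*} {m0 : MeasurableSpace Ω} (P : Measure Ω)
    (ℱ : Filtration ℕ m0) (arr : Finset (Vec n)) (lam : Vec n) (A : ℕ → Ω → Vec n) : Prop where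
  mem : ∀ k ω, A k ω ∈ arr
  measurable : ∀ k, StronglyMeasurable[ℱ (k + 1)] (A k)
  mean : ∀ k, P[A k | ℱ k] =ᵐ[P] fun _ => lam

/-- The schedules `S` are selected by the Schedule-as-You-Learn algorithm, run on the arrivals `A`:
in slot `k` the arrivals `A_k` are observed, `μ̄_k` is computed by dual averaging,
it is decomposed as a convex combination of schedules with weights `θ_k`,
and `S_k = σ` is drawn with probability `θ_k(σ)`, given the history `ℱ k` and `A_k`. -/
structure IsScheduleAsYouLearn {n : ℕ} {Ω : Type*} {m0 : MeasurableSpace Ω} (P : Measure Ω)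
    (ℱ : Filtration ℕ m0) (sched : Finset (Vec n)) (f : Vec n → ℝ) (lam : Vec n)
    (A s y x : ℕ → Ω → Vec n) (θ : ℕ → Ω → Vec n → ℝ) (S : ℕ → Ω → Vec n) : Prop where
  dual_averaging : IsDualAveraging f (convexHull ℝ (sched : Set (Vec n))) lam A s y x
  primal_adapted : ∀ k, StronglyMeasurable[ℱ k] (x k)
  weight_nonneg : ∀ k ω, ∀ σ ∈ sched, 0 ≤ θ k ω σ
  weight_sum : ∀ k ω, ∑ σ ∈ sched, θ k ω σ = 1
  decomposition : ∀ k ω, ∑ σ ∈ sched, θ k ω σ • σ = runningAvg x k ω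
  mem : ∀ k ω, S k ω ∈ sched
  measurable : ∀ k, StronglyMeasurable[ℱ (k + 1)] (S k)
  sampling : ∀ k, ∀ σ ∈ sched,
    P⟦{ω | S k ω = σ} | ℱ k ⊔ MeasurableSpace.comap (A k) inferInstance⟧
      =ᵐ[P] fun ω => θ k ω σ

end SYL

/-!
The queue is controlled by comparing each slot with the strictly feasible solution `μstar`.

Since the constraint `lam ⪯ u` is inactive at `μstar`, convexity and uniqueness make `μstar` the
only minimizer of `f` on the whole convex hull `C` (`eq_of_le_of_slack`). So a point of `C` far from
`μstar` has an objective gap bounded below (`exists_gap`).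

The dual iteration is `y = [s]⁺`, and the Lagrange dual function drops from its value at `0` at
least at the rate `η ‖y‖`. With step sizes `α`, the function
`Z k = ‖y k‖² + 2 ∑ α i (f (x i) - f μstar) - G² ∑ (α i)²` therefore satisfies
`Z (k + 1) - Z k ≤ 2 α k ⟪y k, A k - lam⟫ - 2 η α k ‖y k‖` (`IsDualAveraging.lyapunov_succ_le`).
Given the history, the noise term has mean zero and variance of order `(α k)² ‖y k‖²`. As
`α k * ‖y k‖` is bounded, the drift absorbs the variance in a small exponential moment:
`E[exp (t * Z k)] ≤ 1` for all `k` (`IsScheduleAsYouLearn.integral_exp_lyapunov_le`).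

If the running average after slot `k` is far from `μstar`, Jensen's inequality forces
`Z (k + 1)` to be of order `√k`, since `∑ α i` grows like `√k` and `∑ (α i)²` only like `log k`.
Hence the distance from `μstar` is at most `η / 2` plus an error whose mean is `O(1 / k)`
(`exists_norm_sub_runningAvg_le`). The queue length is `O(k)` in any case, so in the mean drift of
its square, `2 E⟪Q k, lam - runningAvg x k⟫ + O(1) ≤ -η E‖Q k‖ + O(1)`, these errors cost only a
constant. Summing the drift gives strong stability (`stronglyStable_of_drift`).
-/

namespace SYL

variable {n : ℕ}

/-! ### The componentwise order and the positive part -/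

lemma real_inner_eq_sum (u v : Vec n) : ⟪u, v⟫_ℝ = ∑ j, u j * v j := by
  simp [PiLp.inner_apply, mul_comm]

lemma norm_le_sum_of_nonneg {v : Vec n} (hv : CompLE 0 v) : ‖v‖ ≤ ∑ j, v j := by
  have hv' : ∀ j, 0 ≤ v j := fun j => by simpa using hv j
  refine abs_le_of_sq_le_sq' ?_ (Finset.sum_nonneg fun j _ => hv' j) |>.2
  rw [EuclideanSpace.real_norm_sq_eq]
  exact Finset.sum_sq_le_sq_sum_of_nonneg fun j _ => hv' j

/-- Slater's condition turns into a negative drift proportional to the norm. -/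
lemma inner_sub_le_of_slack {v lam u : Vec n} {η : ℝ} (hη : 0 ≤ η) (hv : CompLE 0 v)
    (hu : CompLE (lam + η • ones n) u) : ⟪v, lam - u⟫_ℝ ≤ -(η * ‖v‖) := by
  have hsum : ⟪v, lam - u⟫_ℝ ≤ -(η * ∑ j, v j) := by
    rw [real_inner_eq_sum, Finset.mul_sum, ← Finset.sum_neg_distrib]
    refine Finset.sum_le_sum fun j _ => ?_
    have h1 : 0 ≤ v j := by simpa using hv j
    have h2 : lam j + η ≤ u j := by simpa [ones] using hu j
    simp only [PiLp.sub_apply]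
    nlinarith
  have := mul_le_mul_of_nonneg_left (norm_le_sum_of_nonneg hv) hη
  linarith

@[simp] lemma pos_apply (v : Vec n) (j : Fin n) : pos v j = max (v j) 0 := rfl

lemma compLE_zero_pos (v : Vec n) : CompLE 0 (pos v) := fun j => by simp

lemma pos_eq_self {v : Vec n} (hv : CompLE 0 v) : pos v = v := by
  ext j
  have : 0 ≤ v j := by simpa using hv j
  simpa using this

lemma continuous_pos : Continuous (pos : Vec n → Vec n) := by
  unfold pos
  fun_prop

/-- The function `v ↦ ‖[v]⁺‖² / 2` has the gradient `[v]⁺`, which is `1`-Lipschitz. -/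
lemma norm_sq_pos_add_le (v d : Vec n) :
    ‖pos (v + d)‖ ^ 2 ≤ ‖pos v‖ ^ 2 + 2 * ⟪pos v, d⟫_ℝ + ‖d‖ ^ 2 := by
  simp only [EuclideanSpace.real_norm_sq_eq, real_inner_eq_sum, Finset.mul_sum,
    ← Finset.sum_add_distrib]
  refine Finset.sum_le_sum fun j _ => ?_
  simp only [pos_apply, PiLp.add_apply]
  rcases max_cases (v j + d j) 0 with ⟨h, h'⟩ | ⟨h, h'⟩ <;>
    rcases max_cases (v j) 0 with ⟨g, g'⟩ | ⟨g, g'⟩ <;> rw [h, g] <;>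
    nlinarith [sq_nonneg (v j + d j), sq_nonneg (d j)]

lemma norm_pos_add_le (v d : Vec n) : ‖pos (v + d)‖ ≤ ‖pos v‖ + ‖d‖ := by
  refine abs_le_of_sq_le_sq' ?_ (by positivity) |>.2
  have := norm_sq_pos_add_le v d
  have := real_inner_le_norm (pos v) d
  nlinarith

/-- The dual step with regularizer `‖v‖² / 2` is the projection to the nonnegative orthant. -/
lemma eq_pos_of_isMaxOn {s y : Vec n} (hy : CompLE 0 y)
    (h : IsMaxOn (fun v => ⟪s, v⟫_ℝ - (1 / 2) * ‖v‖ ^ 2) {v | CompLE 0 v} y) : y = pos s := by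
  have h1 : ⟪s, pos s⟫_ℝ - (1 / 2) * ‖pos s‖ ^ 2 ≤ ⟪s, y⟫_ℝ - (1 / 2) * ‖y‖ ^ 2 :=
    h (compLE_zero_pos s)
  -- `⟪[s]⁺ - s, v⟫ ≥ 0` for `v ⪰ 0`, with equality for `v = [s]⁺`
  have h2 : ‖y - pos s‖ ^ 2 ≤ 2 * (⟪s, pos s⟫_ℝ - (1 / 2) * ‖pos s‖ ^ 2)
      - 2 * (⟪s, y⟫_ℝ - (1 / 2) * ‖y‖ ^ 2) := by
    simp only [EuclideanSpace.real_norm_sq_eq, real_inner_eq_sum, mul_sub, Finset.mul_sum,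
      ← Finset.sum_sub_distrib]
    refine Finset.sum_le_sum fun j _ => ?_
    have hj : 0 ≤ y j := by simpa using hy j
    simp only [pos_apply, PiLp.sub_apply]
    rcases max_cases (s j) 0 with ⟨g, g'⟩ | ⟨g, g'⟩ <;> rw [g] <;> nlinarith
  have h3 : ‖y - pos s‖ ^ 2 ≤ 0 := by linarith
  have h4 : ‖y - pos s‖ = 0 := by
    have := norm_nonneg (y - pos s)
    nlinarith
  exact sub_eq_zero.1 (norm_eq_zero.1 h4)

/-! ### The strictly feasible solution minimizes the objective without the constraint -/

lemma abs_apply_le_norm (v : Vec n) (j : Fin n) : |v j| ≤ ‖v‖ := by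
  simpa using PiLp.norm_apply_le v j

/-- Near a strictly feasible point the constraint `lam ⪯ u` is inactive, so by convexity a point of
`C` that is as good as `μstar` gives a further feasible solution on the segment to `μstar`. -/
lemma eq_of_le_of_slack {f : Vec n → ℝ} (hf : ConvexOn ℝ Set.univ f) {C : Set (Vec n)}
    (hC : Convex ℝ C) {lam μstar : Vec n} (hμ : ∀ x, IsSolution f C lam x ↔ x = μstar)
    {η : ℝ} (hη : 0 < η) (hslack : CompLE (lam + η • ones n) μstar)
    {u : Vec n} (hu : u ∈ C) (hle : f u ≤ f μstar) : u = μstar := by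
  obtain ⟨⟨hmem, hfeas⟩, hmin⟩ := (hμ μstar).2 rfl
  -- the step `t` keeps every coordinate of the segment point within `η` of `μstar`
  set r := ‖u - μstar‖
  have hr : 0 ≤ r := norm_nonneg _
  set t := η / (η + r) with ht
  have ht0 : 0 < t := by positivity
  have ht1 : t ≤ 1 := by rw [ht, div_le_one (by positivity)]; linarith
  have htr : t * r ≤ η := by
    rw [ht, div_mul_eq_mul_div, div_le_iff₀ (by positivity)]
    nlinarith [sq_nonneg η]
  set w := (1 - t) • μstar + t • u
  have hfw : f w ≤ f μstar := by
    have := hf.2 (Set.mem_univ μstar) (Set.mem_univ u) (sub_nonneg.2 ht1) ht0.le (by ring)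
    simp only [smul_eq_mul] at this
    nlinarith
  have hw : IsSolution f C lam w := by
    refine ⟨⟨hC hmem hu (sub_nonneg.2 ht1) ht0.le (by ring), fun j => ?_⟩,
      fun v hv => hfw.trans (hmin hv)⟩
    have h1 : lam j + η ≤ μstar j := by simpa [ones] using hslack j
    have h2 : |u j - μstar j| ≤ r := abs_apply_le_norm (u - μstar) j
    have h3 := mul_le_mul_of_nonneg_left (abs_le.1 h2).1 ht0.le
    simp only [w, PiLp.add_apply, PiLp.smul_apply, smul_eq_mul]
    nlinarith
  have hz : t • (u - μstar) = 0 := by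
    rw [← sub_eq_zero.2 ((hμ w).1 hw)]
    module
  exact sub_eq_zero.1 ((smul_eq_zero.1 hz).resolve_left ht0.ne')

lemma exists_gap {f : Vec n → ℝ} (hf : Continuous f) {C : Set (Vec n)} (hC : IsCompact C)
    {μ : Vec n} (huniq : ∀ u ∈ C, f u ≤ f μ → u = μ) {ε : ℝ} (hε : 0 < ε) :
    ∃ δ > 0, ∀ u ∈ C, ε ≤ ‖μ - u‖ → f μ + δ ≤ f u := by
  have hK : IsCompact (C ∩ {u | ε ≤ ‖μ - u‖}) :=
    hC.inter_right (isClosed_le continuous_const (by fun_prop))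
  rcases (C ∩ {u | ε ≤ ‖μ - u‖}).eq_empty_or_nonempty with h | h
  · exact ⟨1, one_pos, fun u hu hu' => absurd (h.subset ⟨hu, hu'⟩) (by simp)⟩
  · obtain ⟨v, ⟨hv, hv'⟩, hmin⟩ := hK.exists_isMinOn h hf.continuousOn
    refine ⟨f v - f μ, ?_, fun u hu hu' => ?_⟩
    · by_contra hcon
      have := huniq v hv (by linarith)
      subst this
      simp only [Set.mem_ofPred_eq, sub_self, norm_zero] at hv'
      linarith
    · have : f v ≤ f u := hmin ⟨hu, hu'⟩
      linarith

/-! ### Sums of the step sizes -/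

lemma stepSize_pos (k : ℕ) : 0 < stepSize k := by
  unfold stepSize
  positivity

lemma sum_stepSize_le (k : ℕ) : ∑ i ∈ Finset.range k, stepSize i ≤ 2 * √k := by
  induction k with
  | zero => simp
  | succ k ih =>
    rw [Finset.sum_range_succ]
    have h1 := Real.sq_sqrt (show (0 : ℝ) ≤ k by positivity)
    have h2 := Real.sq_sqrt (show (0 : ℝ) ≤ (k : ℝ) + 1 by positivity)
    have h3 : 0 < √((k : ℝ) + 1) := by positivity
    have h4 : stepSize k ≤ 2 * (√((k : ℝ) + 1) - √k) := by
      unfold stepSize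
      rw [div_le_iff₀ h3]
      nlinarith [sq_nonneg (√((k : ℝ) + 1) - √k)]
    push_cast
    linarith

lemma sqrt_le_sum_stepSize (k : ℕ) :
    √((k : ℝ) + 1) ≤ ∑ i ∈ Finset.range (k + 1), stepSize i := by
  have h : ∀ i ∈ Finset.range (k + 1), 1 / √((k : ℝ) + 1) ≤ stepSize i := fun i hi => by
    have : (i : ℝ) ≤ k := by exact_mod_cast Finset.mem_range_succ_iff.1 hi
    unfold stepSize
    gcongr
  have := Finset.card_nsmul_le_sum _ _ _ h
  refine le_of_eq_of_le ?_ this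
  simp only [Finset.card_range, nsmul_eq_mul]
  push_cast
  rw [mul_one_div, Real.div_sqrt]

lemma sum_stepSize_sq_le (k : ℕ) :
    ∑ i ∈ Finset.range k, stepSize i ^ 2 ≤ 1 + Real.log k := by
  refine le_of_eq_of_le ?_ (harmonic_le_one_add_log k)
  rw [harmonic]
  push_cast
  refine Finset.sum_congr rfl fun i _ => ?_
  unfold stepSize
  rw [div_pow, Real.sq_sqrt (by positivity)]
  simp

lemma exists_log_le_sqrt {p r : ℝ} (hp : 0 < p) (hr : 0 < r) :
    ∃ c, ∀ z : ℝ, 0 < z → p * (1 + Real.log z) ≤ r * √z + c := by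
  -- the tangent bound `log w ≤ w - 1` at `w = r / (2 * p) * √z`, where `2 * p * w = r * √z`
  refine ⟨p * (-1 - 2 * Real.log (r / (2 * p))), fun z hz => ?_⟩
  have hs : 0 < √z := by positivity
  have h1 := Real.log_le_sub_one_of_pos (show 0 < r / (2 * p) * √z by positivity)
  rw [Real.log_mul (by positivity) hs.ne', Real.log_sqrt hz.le] at h1
  have h2 : p * (r / (2 * p) * √z) = r * √z / 2 := by field_simp
  nlinarith [mul_le_mul_of_nonneg_left h1 hp.le]

/-! ### Dual averaging along one path -/

section Path

variable {Ω : Type*} {f : Vec n → ℝ} {C : Set (Vec n)} {lam : Vec n} {A s y x : ℕ → Ω → Vec n}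

lemma IsDualAveraging.dual_eq (h : IsDualAveraging f C lam A s y x) (k : ℕ) (ω : Ω) :
    y k ω = pos (s k ω) :=
  eq_pos_of_isMaxOn (h.dual_nonneg k ω) (h.dual_argmax k ω)

lemma IsDualAveraging.norm_dual_le (h : IsDualAveraging f C lam A s y x) {G : ℝ}
    (hG : ∀ k ω, ‖A k ω - x k ω‖ ≤ G) (k : ℕ) (ω : Ω) :
    ‖y k ω‖ ≤ G * ∑ i ∈ Finset.range k, stepSize i := by
  induction k with
  | zero =>
    rw [h.dual_eq, h.init, pos_eq_self fun j => le_rfl]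
    simp
  | succ k ih =>
    rw [Finset.sum_range_succ, h.dual_eq, h.step]
    refine (norm_pos_add_le _ _).trans ?_
    rw [← h.dual_eq, norm_smul, Real.norm_of_nonneg (stepSize_pos k).le]
    have := mul_le_mul_of_nonneg_left (hG k ω) (stepSize_pos k).le
    linarith

lemma IsDualAveraging.stepSize_mul_norm_dual_le (h : IsDualAveraging f C lam A s y x) {G : ℝ}
    (hG0 : 0 ≤ G) (hG : ∀ k ω, ‖A k ω - x k ω‖ ≤ G) (k : ℕ) (ω : Ω) :
    stepSize k * ‖y k ω‖ ≤ 2 * G := by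
  have h1 := (h.norm_dual_le hG k ω).trans (mul_le_mul_of_nonneg_left (sum_stepSize_le k) hG0)
  have h2 : stepSize k * √k ≤ 1 := by
    unfold stepSize
    rw [one_div_mul_eq_div, div_le_one (by positivity)]
    exact Real.sqrt_le_sqrt (by linarith)
  have h3 := mul_le_mul_of_nonneg_left h1 (stepSize_pos k).le
  nlinarith

/-- The Lyapunov function of dual averaging: the squared dual point plus twice the weighted sum of
the optimality gaps, compensated for the second-order terms of the steps. -/
noncomputable def lyapunov (f : Vec n → ℝ) (fstar G : ℝ) (y x : ℕ → Ω → Vec n) (k : ℕ) (ω : Ω) :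
    ℝ :=
  ‖y k ω‖ ^ 2 + 2 * ∑ i ∈ Finset.range k, stepSize i * (f (x i ω) - fstar)
    - G ^ 2 * ∑ i ∈ Finset.range k, stepSize i ^ 2

lemma IsDualAveraging.lyapunov_zero (h : IsDualAveraging f C lam A s y x) (fstar G : ℝ) (ω : Ω) :
    lyapunov f fstar G y x 0 ω = 0 := by
  have : y 0 ω = 0 := by rw [h.dual_eq, h.init, pos_eq_self fun j => le_rfl]
  simp [lyapunov, this]

/-- The drift `-‖y‖` comes from comparing the Lagrangian minimizer with the Slater point. -/
lemma IsDualAveraging.lyapunov_succ_le (h : IsDualAveraging f C lam A s y x) {G : ℝ}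
    (hG : ∀ k ω, ‖A k ω - x k ω‖ ≤ G) {μ : Vec n} (hμ : μ ∈ C) {η : ℝ} (hη : 0 ≤ η)
    (hslack : CompLE (lam + η • ones n) μ) (k : ℕ) (ω : Ω) :
    lyapunov f (f μ) G y x (k + 1) ω ≤ lyapunov f (f μ) G y x k ω
      + (2 * stepSize k * ⟪y k ω, A k ω - lam⟫_ℝ - 2 * stepSize k * (η * ‖y k ω‖)) := by
  have hα := stepSize_pos k
  have h1 : f (x k ω) + ⟪y k ω, lam - x k ω⟫_ℝ ≤ f μ + ⟪y k ω, lam - μ⟫_ℝ :=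
    h.primal_argmin k ω hμ
  have h2 := inner_sub_le_of_slack hη (h.dual_nonneg k ω) hslack
  have h3 := norm_sq_pos_add_le (s k ω) (stepSize k • (A k ω - x k ω))
  rw [← h.step, ← h.dual_eq, ← h.dual_eq, norm_smul, Real.norm_of_nonneg hα.le,
    inner_smul_right] at h3
  have h4 : ⟪y k ω, A k ω - x k ω⟫_ℝ = ⟪y k ω, A k ω - lam⟫_ℝ + ⟪y k ω, lam - x k ω⟫_ℝ := by
    rw [← inner_add_right]
    congr 1
    abel
  have h5 : (stepSize k * ‖A k ω - x k ω‖) ^ 2 ≤ stepSize k ^ 2 * G ^ 2 := by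
    rw [mul_pow]
    gcongr
    exact hG k ω
  have h6 : stepSize k * ⟪y k ω, lam - x k ω⟫_ℝ
      ≤ stepSize k * (f μ - f (x k ω) - η * ‖y k ω‖) :=
    mul_le_mul_of_nonneg_left (by linarith) hα.le
  rw [h4] at h3
  simp only [lyapunov, Finset.sum_range_succ]
  nlinarith

lemma runningAvg_mem (hC : Convex ℝ C) {x : ℕ → Ω → Vec n} (hx : ∀ k ω, x k ω ∈ C)
    (k : ℕ) (ω : Ω) : runningAvg x k ω ∈ C := by
  unfold runningAvg
  exact hC.centerMass_mem (fun i _ => (stepSize_pos i).le)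
    (Finset.sum_pos (fun i _ => stepSize_pos i) (by simp)) fun i _ => hx i ω

/-- By Jensen's inequality, a gap at the running average forces the Lyapunov function up at the rate
`√k`, up to a logarithm. -/
lemma le_lyapunov_of_gap (hf : ConvexOn ℝ Set.univ f) {fstar G δ : ℝ} {y x : ℕ → Ω → Vec n}
    {k : ℕ} {ω : Ω} (hδ : 0 ≤ δ) (hgap : fstar + δ ≤ f (runningAvg x k ω)) :
    2 * δ * √((k : ℝ) + 1) - G ^ 2 * (1 + Real.log ((k : ℝ) + 1))
      ≤ lyapunov f fstar G y x (k + 1) ω := by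
  have hpos : 0 < ∑ i ∈ Finset.range (k + 1), stepSize i :=
    Finset.sum_pos (fun i _ => stepSize_pos i) (by simp)
  have hJ : f (runningAvg x k ω) ≤ (∑ i ∈ Finset.range (k + 1), stepSize i)⁻¹
      * ∑ i ∈ Finset.range (k + 1), stepSize i * f (x i ω) := by
    have := hf.map_centerMass_le (t := Finset.range (k + 1)) (w := stepSize) (p := fun i => x i ω)
      (fun i _ => (stepSize_pos i).le) hpos fun i _ => Set.mem_univ _
    simpa [Finset.centerMass, runningAvg] using this
  have h1 : (fstar + δ) * ∑ i ∈ Finset.range (k + 1), stepSize i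
      ≤ ∑ i ∈ Finset.range (k + 1), stepSize i * f (x i ω) := by
    rw [← le_div_iff₀ hpos, div_eq_inv_mul]
    exact hgap.trans hJ
  have h2 := sum_stepSize_sq_le (k + 1)
  push_cast at h2
  have h3 := mul_le_mul_of_nonneg_left h2 (sq_nonneg G)
  have h4 := mul_le_mul_of_nonneg_left (sqrt_le_sum_stepSize k) hδ
  have h5 := sq_nonneg ‖y (k + 1) ω‖
  simp only [lyapunov, mul_sub, Finset.sum_sub_distrib, ← Finset.sum_mul]
  linarith

/-- The running average is within `ε` of the minimizer, except for an error that is dominated by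
an exponential moment of the Lyapunov function and decays as `1 / k`. -/
lemma exists_norm_sub_runningAvg_le (hf : ConvexOn ℝ Set.univ f) (hfc : Continuous f)
    (hC : IsCompact C) (hCc : Convex ℝ C) {μ : Vec n} (hμ : μ ∈ C)
    (huniq : ∀ u ∈ C, f u ≤ f μ → u = μ) {ε : ℝ} (hε : 0 < ε) {t : ℝ} (ht : 0 < t) (G : ℝ)
    {x : ℕ → Ω → Vec n} (hx : ∀ k ω, x k ω ∈ C) (y : ℕ → Ω → Vec n) :
    ∃ c, 0 ≤ c ∧ ∀ k ω, ‖μ - runningAvg x k ω‖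
      ≤ ε + c / ((k : ℝ) + 1) * Real.exp (t * lyapunov f (f μ) G y x (k + 1) ω) := by
  obtain ⟨δ, hδ, hgap⟩ := exists_gap hfc hC huniq hε
  obtain ⟨R, hR⟩ := hC.isBounded.exists_norm_le
  -- the additional `1` in `p` leaves room for `log (k + 1)`, hence for the factor `1 / (k + 1)`
  obtain ⟨b, hb⟩ := exists_log_le_sqrt (p := t * G ^ 2 + 1) (r := 2 * t * δ)
    (by positivity) (by positivity)
  have hR0 : 0 ≤ R := (norm_nonneg _).trans (hR μ hμ)
  refine ⟨2 * R * Real.exp b, by positivity, fun k ω => ?_⟩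
  have hmem := runningAvg_mem hCc hx k ω
  rcases lt_or_ge ‖μ - runningAvg x k ω‖ ε with hlt | hge
  · have : 0 ≤ 2 * R * Real.exp b / ((k : ℝ) + 1)
        * Real.exp (t * lyapunov f (f μ) G y x (k + 1) ω) := by positivity
    linarith
  · have hk : (0 : ℝ) < (k : ℝ) + 1 := by positivity
    have h1 := le_lyapunov_of_gap (G := G) (y := y) hf hδ.le (hgap _ hmem hge)
    have h2 := hb _ hk
    have h3 : Real.log ((k : ℝ) + 1) ≤ b + t * lyapunov f (f μ) G y x (k + 1) ω := by
      nlinarith [mul_le_mul_of_nonneg_left h1 ht.le]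
    have h4 : (k : ℝ) + 1 ≤ Real.exp b * Real.exp (t * lyapunov f (f μ) G y x (k + 1) ω) := by
      rw [← Real.exp_add, ← Real.log_le_iff_le_exp hk]
      exact h3
    have h5 : ‖μ - runningAvg x k ω‖ ≤ 2 * R :=
      (norm_sub_le _ _).trans (by linarith [hR _ hμ, hR _ hmem])
    have h6 : 2 * R ≤ 2 * R * Real.exp b / ((k : ℝ) + 1)
        * Real.exp (t * lyapunov f (f μ) G y x (k + 1) ω) := by
      rw [div_mul_eq_mul_div, le_div_iff₀ hk, mul_assoc (2 * R)]
      exact mul_le_mul_of_nonneg_left h4 (by positivity)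
    linarith

end Path

/-! ### Conditional means of the arrivals and of the schedules -/

section Stochastic

variable {Ω : Type*} {m0 : MeasurableSpace Ω} {P : Measure Ω}
  {ℱ : Filtration ℕ m0} {arr sched : Finset (Vec n)} {f : Vec n → ℝ} {lam : Vec n}
  {A s y x S : ℕ → Ω → Vec n} {θ : ℕ → Ω → Vec n → ℝ}

lemma integrable_inner_of_bound {V X : Ω → Vec n} {K : ℝ} (hV : AEStronglyMeasurable V P)
    (hVb : ∀ ω, ‖V ω‖ ≤ K) (hX : Integrable X P) : Integrable (fun ω => ⟪V ω, X ω⟫_ℝ) P := by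
  refine (hX.norm.const_mul K).mono' (hV.inner hX.1) (ae_of_all _ fun ω => ?_)
  exact (norm_inner_le_norm _ _).trans (mul_le_mul_of_nonneg_right (hVb ω) (norm_nonneg _))

/-- Against a direction known given `m`, a random vector may be replaced by its conditional mean. -/
lemma integral_inner_eq_of_condExp [IsProbabilityMeasure P] {m : MeasurableSpace Ω} (hm : m ≤ m0)
    {V X Y : Ω → Vec n} {K : ℝ} (hV : StronglyMeasurable[m] V) (hVb : ∀ ω, ‖V ω‖ ≤ K)
    (hX : Integrable X P) (hXY : P[X | m] =ᵐ[P] Y) : ∫ ω, ⟪V ω, X ω⟫_ℝ ∂P = ∫ ω, ⟪V ω, Y ω⟫_ℝ ∂P := by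
  have hint := integrable_inner_of_bound (hV.mono hm).aestronglyMeasurable hVb hX
  have hpull : P[fun ω => ⟪V ω, X ω⟫_ℝ | m] =ᵐ[P] fun ω => ⟪V ω, (P[X | m]) ω⟫_ℝ :=
    condExp_bilin_of_stronglyMeasurable_left (innerSL ℝ) hV hint hX
  rw [← integral_condExp hm]
  refine integral_congr_ae ?_
  filter_upwards [hpull, hXY] with ω h1 h2
  rw [h1, h2]

lemma integrable_of_mem_finset [IsProbabilityMeasure P] {X : Ω → Vec n}
    (hX : StronglyMeasurable X) {F : Finset (Vec n)} (hF : ∀ ω, X ω ∈ F) : Integrable X P := by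
  obtain ⟨B, hB⟩ := F.finite_toSet.isBounded.exists_norm_le
  exact Integrable.of_bound hX.aestronglyMeasurable B (ae_of_all _ fun ω => hB _ (hF ω))

lemma IsArrivalProcess.integrable [IsProbabilityMeasure P]
    (hA : IsArrivalProcess P ℱ arr lam A) (k : ℕ) : Integrable (A k) P :=
  integrable_of_mem_finset ((hA.measurable k).mono (ℱ.le _)) (hA.mem k)

lemma IsScheduleAsYouLearn.integrable [IsProbabilityMeasure P]
    (hS : IsScheduleAsYouLearn P ℱ sched f lam A s y x θ S) (k : ℕ) : Integrable (S k) P :=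
  integrable_of_mem_finset ((hS.measurable k).mono (ℱ.le _)) (hS.mem k)

/-- Given the history and the arrivals, the schedule has the running average as its mean. -/
lemma IsScheduleAsYouLearn.condExp_schedule [IsProbabilityMeasure P]
    (hS : IsScheduleAsYouLearn P ℱ sched f lam A s y x θ S) (k : ℕ) :
    P[S k | ℱ k ⊔ MeasurableSpace.comap (A k) inferInstance] =ᵐ[P] runningAvg x k := by
  have hmeas : ∀ σ, MeasurableSet {ω | S k ω = σ} := fun σ =>
    ((hS.measurable k).mono (ℱ.le _)).measurable (measurableSet_singleton σ)
  have hind : ∀ σ, Integrable ({ω | S k ω = σ}.indicator fun _ => (1 : ℝ)) P := fun σ =>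
    (integrable_const 1).indicator (hmeas σ)
  have hsum : S k = ∑ σ ∈ sched, fun ω => {ω | S k ω = σ}.indicator (fun _ => (1 : ℝ)) ω • σ := by
    ext1 ω
    rw [Finset.sum_apply, Finset.sum_eq_single_of_mem (S k ω) (hS.mem k ω)]
    · simp
    · intro σ _ hσ
      simp [Set.indicator, hσ.symm]
  have hterm : ∀ σ ∈ sched, P[fun ω => {ω | S k ω = σ}.indicator (fun _ => (1 : ℝ)) ω • σ |
      ℱ k ⊔ MeasurableSpace.comap (A k) inferInstance] =ᵐ[P] fun ω => θ k ω σ • σ := by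
    intro σ hσ
    have h1 := condExp_bilin_of_stronglyMeasurable_right (μ := P)
      (m := ℱ k ⊔ MeasurableSpace.comap (A k) inferInstance)
      (ContinuousLinearMap.lsmul ℝ ℝ (E := Vec n)) (g := fun _ => σ)
      stronglyMeasurable_const ((hind σ).smul_const σ) (hind σ)
    filter_upwards [h1, hS.sampling k σ hσ] with ω h1 h2
    simp only [ContinuousLinearMap.lsmul_apply] at h1
    rw [h1, h2]
  have h2 := condExp_finsetSum (μ := P) (s := sched)
    (f := fun σ ω => {ω | S k ω = σ}.indicator (fun _ => (1 : ℝ)) ω • σ)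
    (fun σ _ => (hind σ).smul_const σ) (ℱ k ⊔ MeasurableSpace.comap (A k) inferInstance)
  rw [← hsum] at h2
  have h3 := (ae_ball_iff sched.countable_toSet).2 hterm
  filter_upwards [h2, h3] with ω h2 h3
  rw [h2, Finset.sum_apply, Finset.sum_congr rfl h3, hS.decomposition]

lemma IsScheduleAsYouLearn.stronglyMeasurable_state (hA : IsArrivalProcess P ℱ arr lam A)
    (hS : IsScheduleAsYouLearn P ℱ sched f lam A s y x θ S) (k : ℕ) :
    StronglyMeasurable[ℱ k] (s k) := by
  induction k with
  | zero =>
    rw [show s 0 = fun _ => 0 from funext hS.dual_averaging.init]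
    exact stronglyMeasurable_const
  | succ k ih =>
    rw [show s (k + 1) = _ from funext (hS.dual_averaging.step k)]
    have hle := ℱ.mono k.le_succ
    exact (ih.mono hle).add
      (((hA.measurable k).sub ((hS.primal_adapted k).mono hle)).const_smul (stepSize k))

lemma IsScheduleAsYouLearn.stronglyMeasurable_dual (hA : IsArrivalProcess P ℱ arr lam A)
    (hS : IsScheduleAsYouLearn P ℱ sched f lam A s y x θ S) (k : ℕ) :
    StronglyMeasurable[ℱ k] (y k) := by
  rw [show y k = _ from funext (hS.dual_averaging.dual_eq k)]
  exact continuous_pos.comp_stronglyMeasurable (hS.stronglyMeasurable_state hA k)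

lemma IsScheduleAsYouLearn.stronglyMeasurable_lyapunov (hA : IsArrivalProcess P ℱ arr lam A)
    (hS : IsScheduleAsYouLearn P ℱ sched f lam A s y x θ S) (hf : Continuous f) (fstar G : ℝ)
    (k : ℕ) : StronglyMeasurable[ℱ k] (lyapunov f fstar G y x k) := by
  unfold lyapunov
  refine StronglyMeasurable.sub (((hS.stronglyMeasurable_dual hA k).norm.pow 2).add
    (StronglyMeasurable.const_mul ?_ 2)) stronglyMeasurable_const
  refine Finset.stronglyMeasurable_fun_sum _ fun i hi => StronglyMeasurable.const_mul ?_ _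
  have hi' : ℱ i ≤ ℱ k := ℱ.mono (Finset.mem_range.1 hi).le
  exact (hf.comp_stronglyMeasurable ((hS.primal_adapted i).mono hi')).sub stronglyMeasurable_const

lemma stronglyMeasurable_queue (hA : IsArrivalProcess P ℱ arr lam A)
    (hS : IsScheduleAsYouLearn P ℱ sched f lam A s y x θ S) (q : Vec n) (k : ℕ) :
    StronglyMeasurable[ℱ k] (queue q A S k) := by
  induction k with
  | zero => exact stronglyMeasurable_const
  | succ k ih =>
    have hle := ℱ.mono k.le_succ
    exact continuous_pos.comp_stronglyMeasurable
      (((ih.mono hle).add (hA.measurable k)).sub (hS.measurable k))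

/-! ### An exponential moment of the Lyapunov function -/

/-- A compensated exponential is dominated by `1` plus a multiple of its linear term, once the
quadratic remainder is absorbed by the drift `d`. -/
lemma exp_sub_le_one_add {X d : ℝ} (hX : |X| ≤ 1) (hd : X ^ 2 ≤ d) :
    Real.exp (X - d) ≤ 1 + Real.exp (-d) * X := by
  have h1 := (abs_le.1 (Real.abs_exp_sub_one_sub_id_le hX)).2
  have h2 := Real.add_one_le_exp d
  have h3 := Real.exp_pos (-d)
  have h4 : Real.exp (-d) * Real.exp d = 1 := by rw [← Real.exp_add]; simp
  rw [sub_eq_neg_add, Real.exp_add]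
  nlinarith

/-- Small exponential moments of the Lyapunov function do not grow:
the variance of the noise `⟪y, A - lam⟫` is of order `‖y‖²`, while the step times `‖y‖` is bounded,
so that the drift `-‖y‖` absorbs it. -/
lemma IsScheduleAsYouLearn.integral_exp_lyapunov_le [IsProbabilityMeasure P]
    (hA : IsArrivalProcess P ℱ arr lam A)
    (hS : IsScheduleAsYouLearn P ℱ sched f lam A s y x θ S) (hf : Continuous f) {G : ℝ}
    (hG : 1 ≤ G) (hAx : ∀ k ω, ‖A k ω - x k ω‖ ≤ G) (hAl : ∀ k ω, ‖A k ω - lam‖ ≤ G)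
    {μ : Vec n} (hμ : μ ∈ convexHull ℝ (sched : Set (Vec n))) {η : ℝ} (hη : 0 < η)
    (hslack : CompLE (lam + η • ones n) μ) {t : ℝ} (ht : 0 < t) (ht1 : t * (4 * G ^ 2) ≤ 1)
    (ht2 : t * (4 * G ^ 3) ≤ η) (k : ℕ) :
    Integrable (fun ω => Real.exp (t * lyapunov f (f μ) G y x k ω)) P ∧
      ∫ ω, Real.exp (t * lyapunov f (f μ) G y x k ω) ∂P ≤ 1 := by
  have hG0 : 0 ≤ G := by linarith
  set W : ℕ → Ω → ℝ := fun k ω => Real.exp (t * lyapunov f (f μ) G y x k ω) with hW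
  have hWm : ∀ k, StronglyMeasurable[ℱ k] (W k) := fun k =>
    Real.continuous_exp.comp_stronglyMeasurable
      ((hS.stronglyMeasurable_lyapunov hA hf (f μ) G k).const_mul t)
  have hW0 : ∀ k ω, 0 < W k ω := fun k ω => Real.exp_pos _
  have hyb : ∀ k ω, stepSize k * ‖y k ω‖ ≤ 2 * G :=
    hS.dual_averaging.stepSize_mul_norm_dual_le hG0 hAx
  -- `d` is the drift and `V` the predictable direction that the noise `A - lam` is tested with
  set d : ℕ → Ω → ℝ := fun k ω => 2 * t * stepSize k * (η * ‖y k ω‖) with hd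
  set V : ℕ → Ω → Vec n := fun k ω =>
    (W k ω * Real.exp (-d k ω) * (2 * t * stepSize k)) • y k ω with hV
  have hd0 : ∀ k ω, 0 ≤ d k ω := fun k ω => by
    have := stepSize_pos k
    positivity
  have hstep : ∀ k ω, W (k + 1) ω ≤ W k ω + ⟪V k ω, A k ω - lam⟫_ℝ := by
    intro k ω
    set X := 2 * t * stepSize k * ⟪y k ω, A k ω - lam⟫_ℝ with hX
    have hα := stepSize_pos k
    have hXle : |X| ≤ 2 * t * (stepSize k * ‖y k ω‖) * G := by
      rw [hX, abs_mul, abs_of_nonneg (by positivity)]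
      have h1 := (abs_real_inner_le_norm (y k ω) (A k ω - lam)).trans
        (mul_le_mul_of_nonneg_left (hAl k ω) (norm_nonneg _))
      calc _ ≤ 2 * t * stepSize k * (‖y k ω‖ * G) := by gcongr
        _ = _ := by ring
    have hX1 : |X| ≤ 1 := by
      refine hXle.trans (le_trans ?_ ht1)
      have := mul_le_mul_of_nonneg_left (hyb k ω) (show 0 ≤ 2 * t * G by positivity)
      nlinarith
    have hX2 : X ^ 2 ≤ d k ω := by
      rw [← sq_abs, sq]
      have ha : 0 ≤ stepSize k * ‖y k ω‖ := by positivity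
      calc |X| * |X| ≤ (2 * t * (2 * G) * G) * (2 * t * (stepSize k * ‖y k ω‖) * G) := by
            refine mul_le_mul (hXle.trans ?_) hXle (abs_nonneg _) (by positivity)
            have := hyb k ω
            gcongr ?_ * G
            exact mul_le_mul_of_nonneg_left this (by positivity)
        _ = (t * (4 * G ^ 3)) * (2 * t * (stepSize k * ‖y k ω‖)) := by ring
        _ ≤ η * (2 * t * (stepSize k * ‖y k ω‖)) := by gcongr
        _ = d k ω := by simp only [hd]; ring
    have h1 := hS.dual_averaging.lyapunov_succ_le hAx hμ hη.le hslack k ω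
    have h2 : W (k + 1) ω ≤ W k ω * Real.exp (X - d k ω) := by
      simp only [hW]
      rw [← Real.exp_add, Real.exp_le_exp]
      have := mul_le_mul_of_nonneg_left h1 ht.le
      simp only [hX, hd]
      linarith
    have h3 := mul_le_mul_of_nonneg_left (exp_sub_le_one_add hX1 hX2) (hW0 k ω).le
    refine h2.trans (h3.trans_eq ?_)
    simp only [hV, real_inner_smul_left, hX]
    ring
  have hVW : ∀ k ω, ‖V k ω‖ ≤ W k ω * (4 * t * G) := by
    intro k ω
    have hα := stepSize_pos k
    have hw := (hW0 k ω).le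
    have h1 : Real.exp (-d k ω) ≤ 1 := Real.exp_le_one_iff.2 (neg_nonpos.2 (hd0 k ω))
    rw [hV, norm_smul, Real.norm_of_nonneg (by positivity)]
    calc _ = W k ω * Real.exp (-d k ω) * (2 * t * (stepSize k * ‖y k ω‖)) := by ring
      _ ≤ W k ω * 1 * (2 * t * (2 * G)) := by
        have := mul_le_mul_of_nonneg_left (hyb k ω) (show 0 ≤ 2 * t by positivity)
        gcongr
      _ = _ := by ring
  -- a bound that depends on `k` suffices, for integrability only
  have hbdd : ∀ k, ∃ K, ∀ ω, W k ω ≤ K := by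
    intro k
    induction k with
    | zero => exact ⟨1, fun ω => by simp [hW, hS.dual_averaging.lyapunov_zero]⟩
    | succ k ih =>
      obtain ⟨K, hK⟩ := ih
      refine ⟨K + K * (4 * t * G) * G, fun ω => (hstep k ω).trans ?_⟩
      have h1 := real_inner_le_norm (V k ω) (A k ω - lam)
      have h2 : ‖V k ω‖ * ‖A k ω - lam‖ ≤ W k ω * (4 * t * G) * G :=
        mul_le_mul (hVW k ω) (hAl k ω) (norm_nonneg _)
          (mul_nonneg (hW0 k ω).le (by positivity))
      have h3 : W k ω * (4 * t * G) * G ≤ K * (4 * t * G) * G := by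
        gcongr
        exact hK ω
      linarith [hK ω]
  have hWint : ∀ k, Integrable (W k) P := fun k => by
    obtain ⟨K, hK⟩ := hbdd k
    refine Integrable.of_bound ((hWm k).mono (ℱ.le k)).aestronglyMeasurable K
      (ae_of_all _ fun ω => ?_)
    rw [Real.norm_of_nonneg (hW0 k ω).le]
    exact hK ω
  refine ⟨hWint k, ?_⟩
  change ∫ ω, W k ω ∂P ≤ 1
  induction k with
  | zero => simp [hW, hS.dual_averaging.lyapunov_zero]
  | succ k ih =>
    obtain ⟨K, hK⟩ := hbdd k
    have hdm : StronglyMeasurable[ℱ k] (d k) :=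
      ((hS.stronglyMeasurable_dual hA k).norm.const_mul η).const_mul _
    have hVm : StronglyMeasurable[ℱ k] (V k) :=
      (((hWm k).mul (Real.continuous_exp.comp_stronglyMeasurable hdm.neg)).mul
        stronglyMeasurable_const).smul (hS.stronglyMeasurable_dual hA k)
    have hVK : ∀ ω, ‖V k ω‖ ≤ K * (4 * t * G) := fun ω =>
      (hVW k ω).trans (mul_le_mul_of_nonneg_right (hK ω) (by positivity))
    have hVm' := (hVm.mono (ℱ.le k)).aestronglyMeasurable (μ := P)
    have hi1 := integrable_inner_of_bound hVm' hVK (hA.integrable k)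
    have hi2 := integrable_inner_of_bound hVm' hVK (integrable_const (μ := P) lam)
    have hzero : ∫ ω, ⟪V k ω, A k ω - lam⟫_ℝ ∂P = 0 := by
      simp only [inner_sub_right]
      rw [integral_sub hi1 hi2,
        integral_inner_eq_of_condExp (ℱ.le k) hVm hVK (hA.integrable k) (hA.mean k), sub_self]
    have hi : Integrable (fun ω => ⟪V k ω, A k ω - lam⟫_ℝ) P := by
      simp only [inner_sub_right]
      exact hi1.sub hi2
    calc ∫ ω, W (k + 1) ω ∂P ≤ ∫ ω, (W k ω + ⟪V k ω, A k ω - lam⟫_ℝ) ∂P :=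
          integral_mono (hWint _) ((hWint k).add hi) (hstep k)
      _ = ∫ ω, W k ω ∂P := by rw [integral_add (hWint k) hi, hzero, add_zero]
      _ ≤ 1 := ih

/-! ### The queue -/

lemma compLE_zero_queue {q : Vec n} (hq : CompLE 0 q) (A S : ℕ → Ω → Vec n) (k : ℕ) (ω : Ω) :
    CompLE 0 (queue q A S k ω) := by
  cases k with
  | zero => exact hq
  | succ k => exact compLE_zero_pos _

lemma norm_sq_queue_succ_le {q : Vec n} (hq : CompLE 0 q) {G : ℝ}
    (hG : ∀ k ω, ‖A k ω - S k ω‖ ≤ G) (k : ℕ) (ω : Ω) :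
    ‖queue q A S (k + 1) ω‖ ^ 2
      ≤ ‖queue q A S k ω‖ ^ 2 + 2 * ⟪queue q A S k ω, A k ω - S k ω⟫_ℝ + G ^ 2 := by
  have h := norm_sq_pos_add_le (queue q A S k ω) (A k ω - S k ω)
  rw [← add_sub_assoc, pos_eq_self (compLE_zero_queue hq A S k ω)] at h
  refine h.trans ?_
  gcongr
  exact hG k ω

lemma norm_queue_le {q : Vec n} (hq : CompLE 0 q) {G : ℝ} (hG : ∀ k ω, ‖A k ω - S k ω‖ ≤ G)
    (k : ℕ) (ω : Ω) : ‖queue q A S k ω‖ ≤ ‖q‖ + k * G := by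
  induction k with
  | zero => simp [queue]
  | succ k ih =>
    have h := norm_pos_add_le (queue q A S k ω) (A k ω - S k ω)
    rw [← add_sub_assoc, pos_eq_self (compLE_zero_queue hq A S k ω)] at h
    have h' : ‖queue q A S (k + 1) ω‖ ≤ ‖queue q A S k ω‖ + ‖A k ω - S k ω‖ := h
    push_cast
    linarith [hG k ω]

/-- In the mean, the queue drifts as if `A k - S k` were `lam - runningAvg x k`. -/
lemma integral_inner_queue [IsProbabilityMeasure P] (hA : IsArrivalProcess P ℱ arr lam A)
    (hS : IsScheduleAsYouLearn P ℱ sched f lam A s y x θ S) (q : Vec n) {K : ℝ} (k : ℕ)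
    (hK : ∀ ω, ‖queue q A S k ω‖ ≤ K) :
    ∫ ω, ⟪queue q A S k ω, A k ω - S k ω⟫_ℝ ∂P
      = ∫ ω, ⟪queue q A S k ω, lam - runningAvg x k ω⟫_ℝ ∂P := by
  have hQ := stronglyMeasurable_queue hA hS q k
  have hQ' := (hQ.mono (ℱ.le k)).aestronglyMeasurable (μ := P)
  have hm : ℱ k ⊔ MeasurableSpace.comap (A k) inferInstance ≤ m0 :=
    sup_le (ℱ.le k) ((hA.measurable k).mono (ℱ.le _)).measurable.comap_le
  have hcond := hS.condExp_schedule k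
  have hμ : Integrable (runningAvg x k) P := integrable_condExp.congr hcond
  simp only [inner_sub_right]
  rw [integral_sub (integrable_inner_of_bound hQ' hK (hA.integrable k))
      (integrable_inner_of_bound hQ' hK (hS.integrable k)),
    integral_sub (integrable_inner_of_bound hQ' hK (integrable_const lam))
      (integrable_inner_of_bound hQ' hK hμ),
    integral_inner_eq_of_condExp (ℱ.le k) hQ hK (hA.integrable k) (hA.mean k),
    integral_inner_eq_of_condExp hm (hQ.mono le_sup_left) hK (hS.integrable k) hcond]

/-- A drift inequality with a negative term bounds the time averages of that term. -/
lemma stronglyStable_of_drift {Q : ℕ → Ω → Vec n} (hQ : ∀ k, Integrable (Q k) P) {L : ℕ → ℝ}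
    (hL : ∀ k, 0 ≤ L k) {η c : ℝ} (hη : 0 < η)
    (hdrift : ∀ k, η * ∫ ω, ‖Q k ω‖ ∂P ≤ L k - L (k + 1) + c) : StronglyStable P Q := by
  have hsum : ∀ k : ℕ, η * ∑ i ∈ Finset.range k, ∫ ω, ‖Q i ω‖ ∂P ≤ L 0 + k * c := by
    intro k
    rw [Finset.mul_sum]
    refine (Finset.sum_le_sum fun i _ => hdrift i).trans ?_
    rw [Finset.sum_add_distrib, Finset.sum_range_sub']
    simp only [Finset.sum_const, Finset.card_range, nsmul_eq_mul]
    linarith [hL k]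
  have hbound : ∀ k : ℕ, 1 ≤ k →
      (∑ i ∈ Finset.range k, ∫⁻ ω, ‖Q i ω‖ₑ ∂P) / (k : ℝ≥0∞) ≤ ENNReal.ofReal ((L 0 + c) / η) := by
    intro k hk
    have hk' : (1 : ℝ) ≤ k := by exact_mod_cast hk
    have hk0 : (0 : ℝ) < k := by linarith
    simp only [← ofReal_integral_norm_eq_lintegral_enorm (hQ _)]
    rw [← ENNReal.ofReal_sum_of_nonneg fun i _ => integral_nonneg fun ω => norm_nonneg _,
      ← ENNReal.ofReal_natCast, ← ENNReal.ofReal_div_of_pos hk0]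
    refine ENNReal.ofReal_le_ofReal ?_
    rw [div_le_div_iff₀ hk0 hη]
    nlinarith [hsum k, hL 0]
  refine lt_of_le_of_lt (limsup_le_of_le (by isBoundedDefault) ?_)
    (ENNReal.ofReal_lt_top (r := (L 0 + c) / η))
  filter_upwards [eventually_ge_atTop 1] with k hk using hbound k hk

end Stochastic

end SYL

/-! ### Strong stability -/

theorem mainTheorem1 {n : ℕ} {Ω : Type*} {m0 : MeasurableSpace Ω} (P : Measure Ω)
    [IsProbabilityMeasure P] (ℱ : Filtration ℕ m0)
    (arr sched : Finset (SYL.Vec n)) (lam : SYL.Vec n)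
    (A : ℕ → Ω → SYL.Vec n) (hA : SYL.IsArrivalProcess P ℱ arr lam A)
    (f : SYL.Vec n → ℝ) (hf : ConvexOn ℝ Set.univ f)
    (μstar : SYL.Vec n)
    (hμstar : ∀ x, SYL.IsSolution f (convexHull ℝ (sched : Set (SYL.Vec n))) lam x ↔ x = μstar)
    (η : ℝ) (hη : 0 < η) (hslack : SYL.CompLE (lam + η • SYL.ones n) μstar)
    (s y x : ℕ → Ω → SYL.Vec n) (θ : ℕ → Ω → SYL.Vec n → ℝ) (S : ℕ → Ω → SYL.Vec n)
    (hS : SYL.IsScheduleAsYouLearn P ℱ sched f lam A s y x θ S)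
    (q : SYL.Vec n) (hq : SYL.CompLE 0 q) :
    SYL.StronglyStable P (SYL.queue q A S) := by
  have hfc : Continuous f := continuousOn_univ.1 (hf.continuousOn isOpen_univ)
  have hCcpt : IsCompact (convexHull ℝ (sched : Set (SYL.Vec n))) :=
    sched.finite_toSet.isCompact_convexHull ℝ
  have hCconv : Convex ℝ (convexHull ℝ (sched : Set (SYL.Vec n))) := convex_convexHull ℝ _
  obtain ⟨⟨hmem, -⟩, -⟩ := (hμstar μstar).2 rfl
  have huniq : ∀ u ∈ convexHull ℝ (sched : Set (SYL.Vec n)), f u ≤ f μstar → u = μstar :=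
    fun u hu hle => SYL.eq_of_le_of_slack hf hCconv hμstar hη hslack hu hle
  -- one constant that bounds all the increments
  obtain ⟨B₁, hB₁⟩ := hCcpt.isBounded.exists_norm_le
  obtain ⟨B₂, hB₂⟩ := arr.finite_toSet.isBounded.exists_norm_le
  have hB₁0 : 0 ≤ B₁ := (norm_nonneg _).trans (hB₁ _ hmem)
  set G := 1 + B₁ + |B₂| + ‖lam‖ with hGdef
  have hG1 : 1 ≤ G := by
    have := abs_nonneg B₂
    have := norm_nonneg lam
    linarith
  have hG0 : 0 ≤ G := by linarith
  have hxC := hS.dual_averaging.primal_mem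
  have hA2 : ∀ k ω, ‖A k ω‖ ≤ |B₂| := fun k ω => (hB₂ _ (hA.mem k ω)).trans (le_abs_self _)
  have hAx : ∀ k ω, ‖A k ω - x k ω‖ ≤ G := fun k ω =>
    (norm_sub_le _ _).trans (by linarith [hA2 k ω, hB₁ _ (hxC k ω), norm_nonneg lam])
  have hAS : ∀ k ω, ‖A k ω - S k ω‖ ≤ G := fun k ω =>
    (norm_sub_le _ _).trans (by
      linarith [hA2 k ω, hB₁ _ (subset_convexHull ℝ _ (hS.mem k ω)), norm_nonneg lam])
  have hAl : ∀ k ω, ‖A k ω - lam‖ ≤ G := fun k ω =>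
    (norm_sub_le _ _).trans (by linarith [hA2 k ω])
  -- the exponent is small enough for `t * 4 G² ≤ 1` and `t * 4 G³ ≤ η`
  set t := η / (4 * G ^ 2 * (η + G)) with htdef
  have hGpos : 0 < G := by linarith
  have ht : 0 < t := by positivity
  have ht1 : t * (4 * G ^ 2) ≤ 1 := by
    rw [htdef, div_mul_eq_mul_div, div_le_one (by positivity)]
    nlinarith [pow_pos hGpos 3]
  have ht2 : t * (4 * G ^ 3) ≤ η := by
    rw [htdef, div_mul_eq_mul_div, div_le_iff₀ (by positivity)]
    nlinarith [mul_pos (mul_pos hη hη) (pow_pos hGpos 2)]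
  have hexp := hS.integral_exp_lyapunov_le hA hfc hG1 hAx hAl hmem hη hslack ht ht1 ht2
  obtain ⟨c, hc, hdev⟩ := SYL.exists_norm_sub_runningAvg_le hf hfc hCcpt hCconv hmem huniq
    (half_pos hη) ht G hxC y
  set Q := SYL.queue q A S
  have hQb : ∀ k ω, ‖Q k ω‖ ≤ ‖q‖ + k * G := SYL.norm_queue_le hq hAS
  have hQm : ∀ k, AEStronglyMeasurable (Q k) P := fun k =>
    ((SYL.stronglyMeasurable_queue hA hS q k).mono (ℱ.le k)).aestronglyMeasurable
  have hQi : ∀ k, Integrable (Q k) P := fun k =>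
    Integrable.of_bound (hQm k) _ (ae_of_all _ (hQb k))
  have hQ2i : ∀ k, Integrable (fun ω => ‖Q k ω‖ ^ 2) P := fun k => by
    refine Integrable.of_bound ((hQm k).norm.pow 2) ((‖q‖ + k * G) ^ 2) (ae_of_all _ fun ω => ?_)
    rw [Real.norm_of_nonneg (by positivity)]
    exact pow_le_pow_left₀ (norm_nonneg _) (hQb k ω) 2
  -- the mean drift, where the deviation of the running average costs at most a constant because
  -- the linear growth of the queue is offset by the decay `1 / k`
  have hinner : ∀ k, ∫ ω, ⟪Q k ω, lam - SYL.runningAvg x k ω⟫_ℝ ∂P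
      ≤ -(η / 2) * ∫ ω, ‖Q k ω‖ ∂P + (‖q‖ + G) * c := by
    intro k
    obtain ⟨hei, hele⟩ := hexp (k + 1)
    set E := fun ω => Real.exp (t * SYL.lyapunov f (f μstar) G y x (k + 1) ω)
    have hk : (0 : ℝ) < (k : ℝ) + 1 := by positivity
    have hpt : ∀ ω, ⟪Q k ω, lam - SYL.runningAvg x k ω⟫_ℝ
        ≤ -(η / 2) * ‖Q k ω‖ + (‖q‖ + G) * c * E ω := by
      intro ω
      have h1 : ⟪Q k ω, lam - SYL.runningAvg x k ω⟫_ℝ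
          = ⟪Q k ω, lam - μstar⟫_ℝ + ⟪Q k ω, μstar - SYL.runningAvg x k ω⟫_ℝ := by
        rw [← inner_add_right, sub_add_sub_cancel]
      have h2 := SYL.inner_sub_le_of_slack hη.le (SYL.compLE_zero_queue hq A S k ω) hslack
      have h3 := (real_inner_le_norm (Q k ω) (μstar - SYL.runningAvg x k ω)).trans
        (mul_le_mul_of_nonneg_left (hdev k ω) (norm_nonneg _))
      have h4 : ‖Q k ω‖ * (c / ((k : ℝ) + 1)) ≤ (‖q‖ + G) * c := by
        rw [mul_div_assoc', div_le_iff₀ hk]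
        have h5 : ‖Q k ω‖ ≤ (‖q‖ + G) * ((k : ℝ) + 1) := by
          have := mul_nonneg (norm_nonneg q) k.cast_nonneg
          linarith [hQb k ω]
        linarith [mul_le_mul_of_nonneg_right h5 hc]
      have h5 := mul_le_mul_of_nonneg_right h4 (Real.exp_pos
        (t * SYL.lyapunov f (f μstar) G y x (k + 1) ω)).le
      rw [h1]
      linarith
    have hμi : Integrable (SYL.runningAvg x k) P := integrable_condExp.congr (hS.condExp_schedule k)
    calc _ ≤ ∫ ω, (-(η / 2) * ‖Q k ω‖ + (‖q‖ + G) * c * E ω) ∂P :=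
          integral_mono (SYL.integrable_inner_of_bound (hQm k) (hQb k)
            ((integrable_const lam).sub hμi))
            (((hQi k).norm.const_mul _).add (hei.const_mul _)) hpt
      _ = -(η / 2) * ∫ ω, ‖Q k ω‖ ∂P + (‖q‖ + G) * c * ∫ ω, E ω ∂P := by
          rw [integral_add ((hQi k).norm.const_mul _) (hei.const_mul _), integral_const_mul,
            integral_const_mul]
      _ ≤ _ := by
          have : (‖q‖ + G) * c * ∫ ω, E ω ∂P ≤ (‖q‖ + G) * c * 1 :=
            mul_le_mul_of_nonneg_left hele (by positivity)
          linarith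
  refine SYL.stronglyStable_of_drift (L := fun k => ∫ ω, ‖Q k ω‖ ^ 2 ∂P) hQi
    (fun k => integral_nonneg fun ω => by positivity) hη
    (c := 2 * ((‖q‖ + G) * c) + G ^ 2) fun k => ?_
  have hii := SYL.integrable_inner_of_bound (hQm k) (hQb k)
    ((hA.integrable k).sub (hS.integrable k))
  have h1 : ∫ ω, ‖Q (k + 1) ω‖ ^ 2 ∂P ≤ ∫ ω, ‖Q k ω‖ ^ 2 ∂P
      + 2 * ∫ ω, ⟪Q k ω, A k ω - S k ω⟫_ℝ ∂P + G ^ 2 := by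
    have h := integral_mono (hQ2i (k + 1))
      (((hQ2i k).add (hii.const_mul 2)).add (integrable_const (G ^ 2)))
      (SYL.norm_sq_queue_succ_le hq hAS k)
    refine h.trans_eq ?_
    rw [integral_add' ((hQ2i k).add (hii.const_mul 2)) (integrable_const _),
      integral_add' (hQ2i k) (hii.const_mul 2)]
    simp only [Pi.sub_apply, integral_const_mul, integral_const, probReal_univ, smul_eq_mul,
      one_mul]
  have h2 := SYL.integral_inner_queue hA hS q k (hQb k)
  have h3 := hinner k
  change η * ∫ ω, ‖Q k ω‖ ∂P ≤ ∫ ω, ‖Q k ω‖ ^ 2 ∂P - ∫ ω, ‖Q (k + 1) ω‖ ^ 2 ∂P + _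
  rw [h2] at h1
  linarith
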